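/- All matrices have entries in $\{0,1\}$; rows are numbered from top to bottom and columns from left to right. The weight $\|A\|_1$ is the number of $1$s of $A$. A matrix $A\in\{0,1\}^{n\times m}$ contains $P\in\{0,1\}^{p\times q}$, written $P\prec A$, if there are rows $r_1<\cdots<r_p$ and columns $c_1<\cdots<c_q$ of $A$ such that $P(i,j)=1$ implies $A(r_i,c_j)=1$. Let $$\operatorname{Ex}(P,n)=\max\{\|A\|_1 : A\in\{0,1\}^{n\times n},\ P\nprec A\}.$$ Let $H=\begin{pmatrix}0&1&0\\1&0&1\end{pmatrix}$ be the hat pattern, let $I_k$ be the $k\times k$ identity matrix, and let $I_k\otimes H$ be the Kronecker product, a $2k\times 3k$ matrix. Define $a_{1,j}=2^j$ for $j\ge 1$, $a_{i,1}=2$ for $i\ge 2$, and $a_{i,j}=w\cdot a_{i-1,w}$ with $w=a_{i,j-1}$ for $i,j\ge 2$. The inverse-Ackermann function is $\alpha(n)=\alpha(n,n)$, where $\alpha(n,m)=\min\{i\ge 1: a_{i,j}\ge m\}$ with $j=\max\{3,\lceil n/m\rceil\}$. Theorem. There is an absolute constant $C$ such that for all integers $k\ge 1$ and $n\ge 1$,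 $$\operatorname{Ex}(I_k\otimes H,n)\le 2(k-1)\,n\,\alpha(n)+C\,k\,n.$$ -/

import Mathlib

open scoped Kronecker

/-- An `n × m` matrix with entries in `{0, 1}`. Row `0` is the top row. -/
abbrev ZeroOneMatrix (n m : ℕ) : Type := Matrix (Fin n) (Fin m) (Fin 2)

namespace ZeroOneMatrix

/-- The weight `‖A‖₁`: the number of 1s of `A`. -/
def weight {n m : ℕ} (A : ZeroOneMatrix n m) : ℕ :=
  (Finset.univ.filter fun p : Fin n × Fin m => A p.1 p.2 = 1).card

/-- `A` contains `P`: there are rows `r₁ < ⋯ < r_k` and columns `c₁ < ⋯ < c_l` such that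
`P(i,j) = 1` implies `A(r_i,c_j) = 1`. -/
def Contains {k l n m : ℕ} (P : ZeroOneMatrix k l) (A : ZeroOneMatrix n m) : Prop :=
  ∃ (r : Fin k → Fin n) (c : Fin l → Fin m), StrictMono r ∧ StrictMono c ∧
    ∀ i j, P i j = 1 → A (r i) (c j) = 1

open Classical in
/-- The extremal function `Ex(P, n, m)`: the maximum weight of an `n × m` 0-1 matrix that does not
contain `P`. -/
noncomputable def Ex₂ {k l : ℕ} (P : ZeroOneMatrix k l) (n m : ℕ) : ℕ :=
  (Finset.univ.filter fun A : ZeroOneMatrix n m => ¬ Contains P A).sup weight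

/-- `Ex(P, n) = Ex(P, n, n)`. -/
noncomputable def Ex {k l : ℕ} (P : ZeroOneMatrix k l) (n : ℕ) : ℕ := Ex₂ P n n

/-- The hat pattern. -/
def hat : ZeroOneMatrix 2 3 :=
  !![0, 1, 0;
     1, 0, 1]

/-- The Kronecker product with rows and columns numbered in the usual (lexicographic) order:
each entry `P(i,j)` is replaced by the block `P(i,j) · Q`. -/
def kron {k l p q : ℕ} (P : ZeroOneMatrix k l) (Q : ZeroOneMatrix p q) :
    ZeroOneMatrix (k * p) (l * q) :=
  Matrix.reindex finProdFinEquiv finProdFinEquiv (P ⊗ₖ Q)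

end ZeroOneMatrix

/-- The variant `a_{i,j}` (`i, j ≥ 1`) of Ackermann's function with
`a_{1,j} = 2 ^ j`, `a_{i,1} = 2` for `i ≥ 2`, and `a_{i,j} = w * a_{i-1,w}` with `w = a_{i,j-1}`
for `i, j ≥ 2`. The values at `i = 0`, and at `j = 0` with `i ≥ 2`, are never used. -/
def ackTable : ℕ → ℕ → ℕ
  | 0, _ => 0
  | 1, j => 2 ^ j
  | _ + 2, 0 => 0
  | _ + 2, 1 => 2
  | i + 2, j + 2 => ackTable (i + 2) (j + 1) * ackTable (i + 1) (ackTable (i + 2) (j + 1))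
termination_by i j => (i, j)

/-- The two-parameter inverse `α(n, m) = min {i ≥ 1 : a_{i,j} ≥ m}` with
`j = max {3, ⌈n / m⌉}`. -/
noncomputable def invAck₂ (n m : ℕ) : ℕ :=
  sInf {i : ℕ | 1 ≤ i ∧ m ≤ ackTable i (max 3 ⌈(n : ℚ) / (m : ℚ)⌉₊)}

/-- The inverse-Ackermann function `α(n) = α(n, n)`. -/
noncomputable def invAck (n : ℕ) : ℕ := invAck₂ n n

/-! Give each 1 a rank: the largest t such that t hats, each strictly below and to the right of the
previous one, fit weakly above and to the left of it. Avoiding the pattern leaves only the ranks 0,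
…, k - 1. Rank 0 is hat-free, hence linear; the other k - 1 classes each cost about 2nα(n). In class
t, points with no t-chain strictly above and to the left number at most one per diagonal. For the
rest, let x(r) be the least column such that a t-chain lies before row r and that column. A hat of
the class whose left leg is not left of x at the apex row would extend a chain and raise the rank;
this is `HatFreeBeyond`. Such sets obey an Ackermann recurrence, `HatBound.of_slabs`: cut the
columns into slabs, recurse on rows inside one slab, and contract slabs to columns for rows meeting
several, at a price of 2 per row and 2 per column. Each level of the table thus adds 2 per row. -/

/-- A set of positions `(row, column)` lying to the right of the boundary `x`, such that the left
leg of each hat lies to the left of the boundary in the row of its apex. -/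
structure HatFreeBeyond (S : Finset (ℕ × ℕ)) (x : ℕ → ℕ) : Prop where
  le_col : ∀ p ∈ S, x p.1 ≤ p.2
  lt_of_hat : ∀ r₁ r₂ c₁ c₂ c₃ : ℕ, r₁ < r₂ → c₁ < c₂ → c₂ < c₃ → (r₁, c₂) ∈ S → (r₂, c₁) ∈ S →
    (r₂, c₃) ∈ S → c₁ < x r₁

/-- The number of nonempty rows. -/
def rowCount (S : Finset (ℕ × ℕ)) : ℕ := (S.image Prod.fst).card

/-- The weight of a hat-free-beyond-a-boundary set spanning `D + 1` consecutive columns is at most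
`N` times the number of its rows, plus `B`. -/
def HatBound (D N B : ℕ) : Prop :=
  ∀ (S : Finset (ℕ × ℕ)) (x : ℕ → ℕ) (a : ℕ), HatFreeBeyond S x →
    (∀ p ∈ S, a ≤ p.2 ∧ p.2 ≤ a + D) → S.card ≤ N * rowCount S + B

theorem HatFreeBeyond.mono {S T : Finset (ℕ × ℕ)} {x : ℕ → ℕ} (h : HatFreeBeyond S x)
    (hT : T ⊆ S) : HatFreeBeyond T x :=
  ⟨fun p hp => h.le_col p (hT hp), fun r₁ r₂ c₁ c₂ c₃ h1 h2 h3 p1 p2 p3 =>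
    h.lt_of_hat r₁ r₂ c₁ c₂ c₃ h1 h2 h3 (hT p1) (hT p2) (hT p3)⟩

theorem HatBound.mono {D N B D' N' B' : ℕ} (h : HatBound D N B) (hD : D' ≤ D) (hN : N ≤ N')
    (hB : B ≤ B') : HatBound D' N' B' := fun S x a hS hc =>
  (h S x a hS fun p hp => ⟨(hc p hp).1, (hc p hp).2.trans (by omega)⟩).trans
    (by gcongr)

/-- The trivial bound: each row has at most `D + 1` entries. -/
theorem hatBound_trivial (D : ℕ) : HatBound D (D + 1) 0 := by
  intro S x a _ hc
  have hsub : S ⊆ S.image Prod.fst ×ˢ Finset.Icc a (a + D) := fun p hp =>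
    Finset.mem_product.2 ⟨Finset.mem_image_of_mem _ hp, Finset.mem_Icc.2 (hc p hp)⟩
  have := Finset.card_le_card hsub
  rw [Finset.card_product, Nat.card_Icc] at this
  have e : a + D + 1 - a = D + 1 := by omega
  rw [e, mul_comm] at this
  exact this

/-- A set in which each row has at most one point is no larger than its number of rows. -/
theorem card_le_rowCount {S R : Finset (ℕ × ℕ)} (hR : ∀ p ∈ S, ∃ q ∈ R, q.1 = p.1)
    (h : ∀ p ∈ S, ∀ q ∈ S, p.1 = q.1 → p.2 = q.2) : S.card ≤ rowCount R := by
  refine Finset.card_le_card_of_injOn Prod.fst (fun p hp => ?_)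
    (fun p hp q hq e => Prod.ext e (h p hp q hq e))
  obtain ⟨q, hq, e⟩ := hR p hp
  exact Finset.mem_coe.2 (Finset.mem_image.2 ⟨q, hq, e⟩)

/-- A set in which each column has at most one point is no larger than its number of columns. -/
theorem card_le_of_col {S : Finset (ℕ × ℕ)} {a D : ℕ} (hc : ∀ p ∈ S, a ≤ p.2 ∧ p.2 ≤ a + D)
    (h : ∀ p ∈ S, ∀ q ∈ S, p.2 = q.2 → ¬ p.1 < q.1) : S.card ≤ D + 1 := by
  have := Finset.card_le_card_of_injOn (s := S) (t := Finset.Icc a (a + D)) Prod.snd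
    (fun p hp => Finset.mem_coe.2 (Finset.mem_Icc.2 (hc p hp)))
    (fun p hp q hq e => Prod.ext
      (le_antisymm (not_lt.1 (h q hq p hp e.symm)) (not_lt.1 (h p hp q hq e))) e)
  rw [Nat.card_Icc] at this
  omega

/-! ### Slab decomposition: local, boundary and interior points -/

section Slabs

variable (S : Finset (ℕ × ℕ)) (x : ℕ → ℕ) (a w : ℕ)

/-- The index of the slab of width `w` that contains column `c`; the slabs start at column `a`. -/
def slab (c : ℕ) : ℕ := (c - a) / w

open Classical in
/-- The points in rows that are contained in slab `s`. -/
noncomputable def localPart (s : ℕ) : Finset (ℕ × ℕ) :=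
  S.filter fun p => ∀ q ∈ S, q.1 = p.1 → slab a w q.2 = s

open Classical in
/-- The points in rows that meet several slabs. -/
noncomputable def globalPart : Finset (ℕ × ℕ) :=
  S.filter fun p => ∃ q ∈ S, q.1 = p.1 ∧ slab a w q.2 ≠ slab a w p.2

/-- The points of the global rows that lie in the slab of the boundary. -/
noncomputable def boundaryPart : Finset (ℕ × ℕ) :=
  (globalPart S a w).filter fun p => slab a w p.2 = slab a w (x p.1)

/-- The points of the global rows that lie beyond the slab of the boundary. -/
noncomputable def interiorPart : Finset (ℕ × ℕ) :=
  (globalPart S a w).filter fun p => slab a w (x p.1) < slab a w p.2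

/-- The result of contracting each slab beyond the boundary to a column. -/
noncomputable def contracted : Finset (ℕ × ℕ) :=
  (interiorPart S x a w).image fun p => (p.1, slab a w p.2)

variable {S x a w}

theorem slab_mono {c d : ℕ} (h : c ≤ d) : slab a w c ≤ slab a w d :=
  Nat.div_le_div_right (Nat.sub_le_sub_right h a)

theorem lt_of_slab_lt {c d : ℕ} (h : slab a w c < slab a w d) : c < d := by
  by_contra hh
  exact absurd (slab_mono (a := a) (w := w) (not_lt.1 hh)) (not_le.2 h)

theorem mem_localPart {s : ℕ} {p : ℕ × ℕ} :
    p ∈ localPart S a w s ↔ p ∈ S ∧ ∀ q ∈ S, q.1 = p.1 → slab a w q.2 = s := by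
  simp [localPart]

theorem mem_globalPart {p : ℕ × ℕ} : p ∈ globalPart S a w ↔
    p ∈ S ∧ ∃ q ∈ S, q.1 = p.1 ∧ slab a w q.2 ≠ slab a w p.2 := by
  simp only [globalPart, Finset.mem_filter]

theorem mem_boundaryPart {p : ℕ × ℕ} : p ∈ boundaryPart S x a w ↔
    p ∈ globalPart S a w ∧ slab a w p.2 = slab a w (x p.1) := by
  simp [boundaryPart]

theorem mem_interiorPart {p : ℕ × ℕ} : p ∈ interiorPart S x a w ↔
    p ∈ globalPart S a w ∧ slab a w (x p.1) < slab a w p.2 := by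
  simp [interiorPart]

theorem globalPart_subset : globalPart S a w ⊆ S := Finset.filter_subset _ _

theorem interiorPart_subset : interiorPart S x a w ⊆ globalPart S a w := Finset.filter_subset _ _

theorem boundaryPart_subset : boundaryPart S x a w ⊆ globalPart S a w := Finset.filter_subset _ _

/-- Columns in distinct slabs are ordered like their slabs, so a contracted hat lifts to a hat of
`S`. Since the boundary slab is discarded, the boundary can move up to the next slab. -/
theorem HatFreeBeyond.contracted (h : HatFreeBeyond S x) :
    HatFreeBeyond (contracted S x a w) fun r => slab a w (x r) + 1 := by
  have key : ∀ r s, (r, s) ∈ _root_.contracted S x a w →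
      ∃ c, (r, c) ∈ S ∧ slab a w c = s ∧ slab a w (x r) < s := by
    intro r s hp
    obtain ⟨⟨r', c⟩, hq, e⟩ := Finset.mem_image.1 hp
    simp only [Prod.mk.injEq] at e
    obtain ⟨rfl, rfl⟩ := e
    exact ⟨c, globalPart_subset (interiorPart_subset hq), rfl, (mem_interiorPart.1 hq).2⟩
  constructor
  · rintro ⟨r, s⟩ hp
    obtain ⟨c, _, _, hlt⟩ := key r s hp
    exact hlt
  · intro r₁ r₂ s₁ s₂ s₃ hr h12 h23 m1 m2 m3
    obtain ⟨c₂, i2, rfl, _⟩ := key _ _ m1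
    obtain ⟨c₁, i1, rfl, _⟩ := key _ _ m2
    obtain ⟨c₃, i3, rfl, _⟩ := key _ _ m3
    have := h.lt_of_hat r₁ r₂ c₁ c₂ c₃ hr (lt_of_slab_lt h12) (lt_of_slab_lt h23) i2 i1 i3
    exact Nat.lt_succ_of_le (slab_mono this.le)

theorem rowCount_contracted_le :
    rowCount (contracted S x a w) ≤ rowCount (globalPart S a w) := by
  refine Finset.card_le_card fun r hr => ?_
  obtain ⟨⟨r', s⟩, hp, rfl⟩ := Finset.mem_image.1 hr
  obtain ⟨q, hq, e⟩ := Finset.mem_image.1 hp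
  exact Finset.mem_image.2 ⟨q, interiorPart_subset hq, (Prod.ext_iff.1 e).1⟩

-- Besides the last boundary point of each row, a column holds at most one. Of two in a column, the
-- upper has an apex to its right in the same slab; the lower row, being global, has a right leg in
-- a later slab. The common column is then a left leg beyond the boundary of the apex row.
open Classical in
theorem card_boundaryPart_le (h : HatFreeBeyond S x) {D : ℕ}
    (hc : ∀ p ∈ S, a ≤ p.2 ∧ p.2 ≤ a + D) :
    (boundaryPart S x a w).card ≤ rowCount (globalPart S a w) + (D + 1) := by
  set T := boundaryPart S x a w with hT
  have hTS : ∀ p ∈ T, p ∈ S := fun p hp => globalPart_subset (boundaryPart_subset hp)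
  rw [← Finset.card_filter_add_card_filter_not (s := T) fun p => ∀ q ∈ T, q.1 = p.1 → q.2 ≤ p.2]
  refine add_le_add (card_le_rowCount (fun p hp => ?_) fun p hp q hq e => ?_)
    (card_le_of_col (a := a) (fun p hp => hc p (hTS p (Finset.mem_filter.1 hp).1))
      fun p hp q hq e hlt => ?_)
  · exact ⟨p, boundaryPart_subset (Finset.mem_filter.1 hp).1, rfl⟩
  · rw [Finset.mem_filter] at hp hq
    exact le_antisymm (hq.2 p hp.1 e) (hp.2 q hq.1 e.symm)
  · rw [Finset.mem_filter] at hp hq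
    obtain ⟨r₁, c₁⟩ := p
    obtain ⟨r₂, c⟩ := q
    obtain ⟨hp, hp'⟩ := hp
    push Not at hp'
    obtain ⟨⟨r, c₂⟩, m2, rfl, h12⟩ := hp'
    dsimp only at e hlt h12
    subst e
    obtain ⟨hg, hs⟩ := mem_boundaryPart.1 hq.1
    obtain ⟨-, ⟨r₃, c₃⟩, m3, rfl, hne⟩ := mem_globalPart.1 hg
    have hlt3 : slab a w c₁ < slab a w c₃ := by
      refine lt_of_le_of_ne ?_ (Ne.symm hne)
      have := slab_mono (a := a) (w := w) (h.le_col _ m3)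
      dsimp only at this hs
      omega
    have e2 := (mem_boundaryPart.1 m2).2
    have e1 := (mem_boundaryPart.1 hp).2
    dsimp only at e1 e2
    have := h.lt_of_hat r r₃ c₁ c₂ c₃ hlt h12
      (lt_of_slab_lt (a := a) (w := w) (by omega)) (hTS _ m2) (hTS _ hq.1) m3
    exact absurd this (not_lt.2 (h.le_col _ (hTS _ hp)))

-- The first point of each row in each slab is counted by the contraction, and the last point of
-- each row once per row. Of two remaining points in a column, the upper is an apex whose legs lie
-- in the lower row, with the left leg in the apex's own slab, beyond the boundary slab.
open Classical in
theorem card_interiorPart_le (h : HatFreeBeyond S x) {D : ℕ}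
    (hc : ∀ p ∈ S, a ≤ p.2 ∧ p.2 ≤ a + D) :
    (interiorPart S x a w).card ≤
      (contracted S x a w).card + (rowCount (globalPart S a w) + (D + 1)) := by
  set T := interiorPart S x a w with hT
  have hTS : ∀ p ∈ T, p ∈ S := fun p hp => globalPart_subset (interiorPart_subset hp)
  rw [← Finset.card_filter_add_card_filter_not (s := T)
    fun p => ∀ q ∈ T, q.1 = p.1 → slab a w q.2 = slab a w p.2 → p.2 ≤ q.2]
  refine add_le_add ?_ ?_
  · refine Finset.card_le_card_of_injOn (fun p => (p.1, slab a w p.2)) (fun p hp => ?_) ?_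
    · exact Finset.mem_coe.2 (Finset.mem_image_of_mem _ (Finset.mem_filter.1 hp).1)
    · intro p hp q hq e
      have hp := Finset.mem_filter.1 hp
      have hq := Finset.mem_filter.1 hq
      simp only [Prod.mk.injEq] at e
      exact Prod.ext e.1 (le_antisymm (hp.2 q hq.1 e.1.symm e.2.symm) (hq.2 p hp.1 e.1 e.2))
  rw [← Finset.card_filter_add_card_filter_not
    (s := T.filter fun p => ¬ ∀ q ∈ T, q.1 = p.1 → slab a w q.2 = slab a w p.2 → p.2 ≤ q.2)
    fun p => ∀ q ∈ T, q.1 = p.1 → q.2 ≤ p.2]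
  refine add_le_add (card_le_rowCount (fun p hp => ?_) fun p hp q hq e => ?_)
    (card_le_of_col (a := a) (fun p hp => ?_) fun p hp q hq e hlt => ?_)
  · simp only [Finset.mem_filter] at hp
    exact ⟨p, interiorPart_subset hp.1.1, rfl⟩
  · rw [Finset.mem_filter, Finset.mem_filter] at hp hq
    exact le_antisymm (hq.2 p hp.1.1 e) (hp.2 q hq.1.1 e.symm)
  · simp only [Finset.mem_filter] at hp
    exact hc p (hTS p hp.1.1)
  · rw [Finset.mem_filter, Finset.mem_filter] at hp hq
    obtain ⟨⟨mp, -⟩, -⟩ := hp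
    obtain ⟨⟨mq, hq1⟩, hq2⟩ := hq
    obtain ⟨r₁, c₂⟩ := p
    obtain ⟨r₂, c⟩ := q
    push Not at hq1 hq2
    obtain ⟨⟨r, c₁⟩, m1, rfl, hs, h12⟩ := hq1
    obtain ⟨⟨r', c₃⟩, m3, hr', h23⟩ := hq2
    dsimp only at e hlt h12 h23 hs hr'
    subst e hr'
    have := h.lt_of_hat r₁ r' c₁ c₂ c₃ hlt h12 h23 (hTS _ mp) (hTS _ m1) (hTS _ m3)
    have h' := (mem_interiorPart.1 mp).2
    dsimp only at h'
    exact absurd (slab_mono (a := a) (w := w) this.le) (by omega)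

theorem card_globalPart_le (h : HatFreeBeyond S x) {D : ℕ}
    (hc : ∀ p ∈ S, a ≤ p.2 ∧ p.2 ≤ a + D) :
    (globalPart S a w).card ≤
      (contracted S x a w).card + 2 * rowCount (globalPart S a w) + 2 * (D + 1) := by
  have hsub : globalPart S a w ⊆ boundaryPart S x a w ∪ interiorPart S x a w := by
    intro p hp
    rw [Finset.mem_union, mem_boundaryPart, mem_interiorPart]
    rcases (slab_mono (a := a) (w := w) (h.le_col p (globalPart_subset hp))).eq_or_lt with e | e
    · exact Or.inl ⟨hp, e.symm⟩
    · exact Or.inr ⟨hp, e⟩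
  have h1 := (Finset.card_le_card hsub).trans (Finset.card_union_le _ _)
  have h2 := card_boundaryPart_le (w := w) h hc
  have h3 := card_interiorPart_le (w := w) h hc
  omega

theorem subset_local_union_global {D : ℕ} (hc : ∀ p ∈ S, a ≤ p.2 ∧ p.2 ≤ a + D) :
    S ⊆ (Finset.range (D / w + 1)).biUnion (localPart S a w) ∪ globalPart S a w := by
  intro p hp
  rw [Finset.mem_union, Finset.mem_biUnion, mem_globalPart]
  by_cases hg : ∃ q ∈ S, q.1 = p.1 ∧ slab a w q.2 ≠ slab a w p.2
  · exact Or.inr ⟨hp, hg⟩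
  · push Not at hg
    refine Or.inl ⟨slab a w p.2, Finset.mem_range.2 (Nat.lt_succ_of_le
      (Nat.div_le_div_right ?_)), mem_localPart.2 ⟨hp, hg⟩⟩
    have := hc p hp
    omega

theorem sum_rowCount_localPart_le (t : Finset ℕ) :
    ∑ s ∈ t, rowCount (localPart S a w s) + rowCount (globalPart S a w) ≤ rowCount S := by
  have hd : (t : Set ℕ).PairwiseDisjoint fun s => (localPart S a w s).image Prod.fst := by
    intro s _ s' _ hne
    refine Finset.disjoint_left.2 fun r h1 h2 => hne ?_
    obtain ⟨p, hp, rfl⟩ := Finset.mem_image.1 h1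
    obtain ⟨q, hq, e⟩ := Finset.mem_image.1 h2
    rw [mem_localPart] at hp hq
    exact (hp.2 p hp.1 rfl).symm.trans (hq.2 p hp.1 e.symm)
  unfold rowCount
  rw [← Finset.card_biUnion fun s hs s' hs' hne => hd hs hs' hne, ← Finset.card_union_of_disjoint]
  · refine Finset.card_le_card (Finset.union_subset (Finset.biUnion_subset.2 fun s _ => ?_)
      (Finset.image_subset_image globalPart_subset))
    exact Finset.image_subset_image (Finset.filter_subset _ _)
  · refine Finset.disjoint_left.2 fun r h1 h2 => ?_
    obtain ⟨s, -, h1⟩ := Finset.mem_biUnion.1 h1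
    obtain ⟨p, hp, rfl⟩ := Finset.mem_image.1 h1
    obtain ⟨q, hq, e⟩ := Finset.mem_image.1 h2
    rw [mem_localPart] at hp
    obtain ⟨mq, q', mq', e', hne⟩ := mem_globalPart.1 hq
    exact hne ((hp.2 q' mq' (e'.trans e)).trans (hp.2 q mq e).symm)

end Slabs

/-! ### The recurrence and its solution -/

/-- The Ackermann-type recurrence: dividing the columns into slabs of width `w`. -/
theorem HatBound.of_slabs {D N M B w : ℕ} (hw : 0 < w) (δ : ℕ → ℕ) (hglob : HatBound (D / w) M B)
    (hMN : M + 2 ≤ N) (hloc : ∀ d < w, HatBound d N (δ d)) :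
    HatBound D N (∑ s ∈ Finset.range (D / w + 1), δ (min (w - 1) (D - s * w)) + B
      + 2 * (D + 1)) := by
  intro S x a hS hc
  have h1 : ∀ s ∈ Finset.range (D / w + 1), (localPart S a w s).card ≤
      N * rowCount (localPart S a w s) + δ (min (w - 1) (D - s * w)) := by
    intro s _
    refine hloc _ (by omega) _ x (a + s * w) (hS.mono (Finset.filter_subset _ _)) fun p hp => ?_
    rw [mem_localPart] at hp
    have e : (p.2 - a) / w = s := hp.2 p hp.1 rfl
    have hp' := hc p hp.1
    have hlo : s * w ≤ p.2 - a := e ▸ Nat.div_mul_le_self _ _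
    have hhi : p.2 - a < s * w + w := by
      have := Nat.lt_mul_of_div_lt (e.trans_lt (Nat.lt_succ_self s)) hw
      rw [Nat.succ_eq_add_one] at this
      linarith
    omega
  have h2 := hglob (contracted S x a w) _ 0 hS.contracted (by
    intro p hp
    obtain ⟨q, hq, rfl⟩ := Finset.mem_image.1 hp
    have := hc q (globalPart_subset (interiorPart_subset hq))
    refine ⟨Nat.zero_le _, ?_⟩
    rw [Nat.zero_add]
    exact Nat.div_le_div_right (by omega))
  have h3 := card_globalPart_le (w := w) hS hc
  have h4 := sum_rowCount_localPart_le (S := S) (a := a) (w := w) (Finset.range (D / w + 1))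
  have h5 := (Finset.card_le_card (subset_local_union_global (w := w) hc)).trans
    (Finset.card_union_le _ _)
  have h6 := Finset.card_biUnion_le.trans (Finset.sum_le_sum h1)
  rw [Finset.sum_add_distrib, ← Finset.mul_sum] at h6
  have h7 := Nat.mul_le_mul_left M (rowCount_contracted_le (S := S) (x := x) (a := a) (w := w))
  have h8 := Nat.mul_le_mul_right (rowCount (globalPart S a w)) hMN
  have h9 := Nat.mul_le_mul_left N h4
  linarith

theorem sum_slab_widths {D w : ℕ} (hw : 0 < w) :
    ∑ s ∈ Finset.range (D / w + 1), (min (w - 1) (D - s * w) + 1) = D + 1 := by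
  have key : ∀ q, q * w ≤ D →
      ∑ s ∈ Finset.range q, (min (w - 1) (D - s * w) + 1) = q * w := by
    intro q
    induction q with
    | zero => simp
    | succ q ih =>
      intro h
      rw [Nat.succ_mul] at h ⊢
      rw [Finset.sum_range_succ, ih (by omega)]
      omega
  have h1 := Nat.div_mul_le_self D w
  have h2 := Nat.lt_div_mul_add (a := D) hw
  rw [Finset.sum_range_succ, key _ h1]
  generalize D / w * w = q at h1 h2 ⊢
  omega

theorem sum_slab_widths_le {D w : ℕ} (hw : 0 < w) :
    ∑ s ∈ Finset.range (D / w + 1), min (w - 1) (D - s * w) ≤ D := by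
  have := sum_slab_widths (D := D) hw
  rw [Finset.sum_add_distrib, Finset.sum_const, Finset.card_range, smul_eq_mul, mul_one] at this
  linarith [Nat.zero_le (D / w)]

theorem ackTable_one (j : ℕ) : ackTable 1 j = 2 ^ j := by rw [ackTable]

theorem ackTable_col_one (i : ℕ) : ackTable (i + 1) 1 = 2 := by
  cases i <;> rw [ackTable]
  norm_num

theorem ackTable_succ (i j : ℕ) : ackTable (i + 2) (j + 2) =
    ackTable (i + 2) (j + 1) * ackTable (i + 1) (ackTable (i + 2) (j + 1)) := by
  rw [ackTable]

theorem ackTable_pos (i j : ℕ) : 0 < ackTable (i + 1) (j + 1) := by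
  induction i generalizing j with
  | zero => rw [ackTable_one]; positivity
  | succ i ih =>
    induction j with
    | zero => rw [ackTable_col_one]; norm_num
    | succ j ihj =>
      rw [ackTable_succ]
      obtain ⟨t, ht⟩ := Nat.exists_eq_add_of_le' ihj
      have := ih t
      rw [← ht] at this
      exact Nat.mul_pos ihj this

theorem le_ackTable_three (i : ℕ) : i + 1 ≤ ackTable (i + 1) 3 := by
  have two : ∀ i, i + 1 ≤ ackTable (i + 1) 2 := by
    intro i
    induction i with
    | zero => rw [ackTable_one]; norm_num
    | succ i ih => rw [ackTable_succ, ackTable_col_one]; omega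
  cases i with
  | zero => rw [ackTable_one]; norm_num
  | succ i =>
    rw [ackTable_succ]
    obtain ⟨t, ht⟩ := Nat.exists_eq_add_of_le' (ackTable_pos (i + 1) 1)
    have := ackTable_pos i t
    rw [← ht] at this
    exact (two (i + 1)).trans (Nat.le_mul_of_pos_right _ this)

/-- The additive term is linear in `D`, one less than the number of columns, because these widths
sum to at most `D` over the slabs. -/
theorem hatBound_ackTable (i j : ℕ) : ∀ D < ackTable (i + 1) (j + 1),
    HatBound D (2 * (i + 1) + 2) (4 * (i + 1) * (j + 1) * D) := by
  have small : ∀ (i D B : ℕ), D ≤ 1 → HatBound D (2 * (i + 1) + 2) B := fun i D B h =>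
    (hatBound_trivial D).mono le_rfl (by omega) (Nat.zero_le _)
  have step : ∀ (i j w D M B : ℕ), 0 < w → D ≠ 0 → HatBound (D / w) M B →
      M + 2 ≤ 2 * (i + 1) + 2 → B ≤ 4 * i * D →
      (∀ d < w, HatBound d (2 * (i + 1) + 2) (4 * (i + 1) * (j + 1) * d)) →
      HatBound D (2 * (i + 1) + 2) (4 * (i + 1) * (j + 1 + 1) * D) := by
    intro i j w D M B hw hD hM hMN hB hloc
    refine (HatBound.of_slabs hw _ hM hMN hloc).mono le_rfl le_rfl ?_
    rw [← Finset.mul_sum]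
    have h1 := Nat.mul_le_mul_left (4 * (i + 1) * (j + 1)) (sum_slab_widths_le (D := D) hw)
    have h2 : 1 ≤ D := Nat.one_le_iff_ne_zero.2 hD
    -- The contraction and the slab charge together cost 4iD + 2(D + 1) ≤ 4(i + 1)D, which needs D ≥
    -- 1.
    nlinarith
  induction i generalizing j with
  | zero =>
    induction j with
    | zero =>
      intro D hD
      rw [ackTable_one] at hD
      exact small _ _ _ (by omega)
    | succ j ih =>
      intro D hD
      rcases eq_or_ne D 0 with rfl | hD0
      · exact small _ _ _ (by omega)
      simp only [zero_add, ackTable_one] at hD ih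
      have hle : D / 2 ^ (j + 1) ≤ 1 := by
        have : D / 2 ^ (j + 1) < 2 := Nat.div_lt_of_lt_mul (by rwa [← pow_succ])
        omega
      exact step 0 j (2 ^ (j + 1)) D 2 0 (by positivity) hD0
        ((hatBound_trivial _).mono le_rfl (by omega) le_rfl) le_rfl (Nat.zero_le _) ih
  | succ i ihi =>
    induction j with
    | zero =>
      intro D hD
      rw [ackTable_col_one] at hD
      exact small _ _ _ (by omega)
    | succ j ih =>
      intro D hD
      rcases eq_or_ne D 0 with rfl | hD0
      · exact small _ _ _ (by omega)
      have hw := ackTable_pos (i + 1) j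
      rw [ackTable_succ] at hD
      obtain ⟨t, ht⟩ := Nat.exists_eq_add_of_le' hw
      set w := ackTable (i + 1 + 1) (j + 1) with hwdef
      -- The previous level is used at column index `w`; the factor `w` in its additive term cancels
      -- against `D / w`.
      have hg := ihi t (D / w) (by
        rw [← ht]
        exact Nat.div_lt_of_lt_mul hD)
      refine step (i + 1) j w D _ _ hw hD0 hg (by omega) ?_ ih
      rw [← ht, mul_assoc]
      exact Nat.mul_le_mul_left _ (Nat.mul_div_le D w)

theorem hatBound_of_lt_sq {i D : ℕ} (h : D < i * i) : HatBound D (i + 2) (2 * (D + 1)) := by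
  have hi : 0 < i := Nat.pos_of_ne_zero (by rintro rfl; simp at h)
  have h1 : D / i < i := Nat.div_lt_of_lt_mul h
  refine (HatBound.of_slabs (N := i + 2) hi (fun _ => 0)
    ((hatBound_trivial (D / i)).mono le_rfl (show _ ≤ i by omega) le_rfl) le_rfl
    fun d hd => (hatBound_trivial d).mono le_rfl (by omega) le_rfl).mono le_rfl le_rfl ?_
  simp

/-- Applied directly, `hatBound_ackTable` has additive term 12(i + 1)D. One preliminary contraction
by slabs of width (i + 1)² absorbs the factor i + 1, for 2 more per row. -/
theorem hatBound_of_lt_ackTable_three {i D : ℕ} (h : D < ackTable (i + 1) 3) :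
    HatBound D (2 * (i + 1) + 4) (16 * (D + 1)) := by
  have hw : 0 < (i + 1) * (i + 1) := by positivity
  refine (HatBound.of_slabs hw (fun d => 2 * (d + 1))
    (hatBound_ackTable i 2 (D / ((i + 1) * (i + 1))) ((Nat.div_le_self _ _).trans_lt h)) le_rfl
    fun d hd => (hatBound_of_lt_sq hd).mono le_rfl (by omega) le_rfl).mono le_rfl le_rfl ?_
  rw [← Finset.mul_sum, sum_slab_widths hw]
  have h1 : (i + 1) * (D / ((i + 1) * (i + 1))) ≤ D := by
    rw [← Nat.div_div_eq_div_mul]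
    exact (Nat.mul_div_le _ _).trans (Nat.div_le_self _ _)
  have h2 : 4 * (i + 1) * (2 + 1) * (D / ((i + 1) * (i + 1)))
      = 12 * ((i + 1) * (D / ((i + 1) * (i + 1)))) := by ring
  rw [h2]
  omega

theorem invAck_spec {n : ℕ} (hn : 1 ≤ n) : 1 ≤ invAck n ∧ n ≤ ackTable (invAck n) 3 := by
  have e : max 3 ⌈(n : ℚ) / (n : ℚ)⌉₊ = 3 := by
    rw [div_self (by positivity), Nat.ceil_one]
    rfl
  have h : invAck n ∈ {i : ℕ | 1 ≤ i ∧ n ≤ ackTable i (max 3 ⌈(n : ℚ) / (n : ℚ)⌉₊)} := by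
    refine Nat.sInf_mem ⟨n, hn, ?_⟩
    rw [e]
    obtain ⟨m, rfl⟩ := Nat.exists_eq_succ_of_ne_zero (by omega : n ≠ 0)
    exact le_ackTable_three m
  rw [e] at h
  exact h

/-! ### Chains of hats and the Kronecker pattern -/

/-- `S` contains `t` hats, each strictly below and to the right of the previous one, all of them
in rows before `r` and columns before `c`. -/
def HatChain (S : Finset (ℕ × ℕ)) : ℕ → ℕ → ℕ → Prop
  | 0, _, _ => True
  | t + 1, r, c => ∃ r₁ r₂ c₁ c₂ c₃, r₁ < r₂ ∧ r₂ < r ∧ c₁ < c₂ ∧ c₂ < c₃ ∧ c₃ < c ∧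
      (r₁, c₂) ∈ S ∧ (r₂, c₁) ∈ S ∧ (r₂, c₃) ∈ S ∧ HatChain S t r₁ c₁

theorem HatChain.mono {S : Finset (ℕ × ℕ)} {t r c r' c' : ℕ} (h : HatChain S t r c)
    (hr : r ≤ r') (hc : c ≤ c') : HatChain S t r' c' := by
  cases t with
  | zero => trivial
  | succ t =>
    obtain ⟨r₁, r₂, c₁, c₂, c₃, h1, h2, h3, h4, h5, h6⟩ := h
    exact ⟨r₁, r₂, c₁, c₂, c₃, h1, by omega, h3, h4, by omega, h6⟩

/-- A chain of hats yields strictly increasing sequences of rows and columns. -/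
theorem HatChain.exists_seq {S : Finset (ℕ × ℕ)} {t r c : ℕ} (h : HatChain S t r c) :
    ∃ f g : ℕ → ℕ, (∀ i j, i < j → j < t * 2 → f i < f j) ∧ (∀ i < t * 2, f i < r) ∧
      (∀ i j, i < j → j < t * 3 → g i < g j) ∧ (∀ i < t * 3, g i < c) ∧
      ∀ s < t, (f (2 * s), g (1 + 3 * s)) ∈ S ∧ (f (1 + 2 * s), g (3 * s)) ∈ S ∧
        (f (1 + 2 * s), g (2 + 3 * s)) ∈ S := by
  induction t generalizing r c with
  | zero => exact ⟨id, id, by omega, by omega, by omega, by omega, by omega⟩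
  | succ t ih =>
    obtain ⟨r₁, r₂, c₁, c₂, c₃, h1, h2, h3, h4, h5, m1, m2, m3, h6⟩ := h
    obtain ⟨f, g, hf, hfr, hg, hgc, hS⟩ := ih h6
    refine ⟨fun i => if i < t * 2 then f i else if i = t * 2 then r₁ else r₂,
      fun i => if i < t * 3 then g i else if i = t * 3 then c₁ else if i = t * 3 + 1 then c₂
        else c₃, ?_, ?_, ?_, ?_, ?_⟩
    · intro i j hij hj
      have := hf i j hij
      have := hfr i
      dsimp only
      split_ifs <;> omega
    · intro i hi
      have := hfr i
      dsimp only
      split_ifs <;> omega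
    · intro i j hij hj
      have := hg i j hij
      have := hgc i
      dsimp only
      split_ifs <;> omega
    · intro i hi
      have := hgc i
      dsimp only
      split_ifs <;> omega
    · intro s hs
      rcases Nat.lt_succ_iff_lt_or_eq.1 hs with hs | rfl
      · dsimp only
        simp only [if_pos (show 2 * s < t * 2 by omega), if_pos (show 1 + 2 * s < t * 2 by omega),
          if_pos (show 3 * s < t * 3 by omega), if_pos (show 1 + 3 * s < t * 3 by omega),
          if_pos (show 2 + 3 * s < t * 3 by omega)]
        exact hS s hs
      · dsimp only
        simp only [if_neg (show ¬ 2 * s < s * 2 by omega), if_pos (show 2 * s = s * 2 by omega),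
          if_neg (show ¬ 1 + 2 * s < s * 2 by omega), if_neg (show ¬ 1 + 2 * s = s * 2 by omega),
          if_neg (show ¬ 3 * s < s * 3 by omega), if_pos (show 3 * s = s * 3 by omega),
          if_neg (show ¬ 1 + 3 * s < s * 3 by omega), if_neg (show ¬ 1 + 3 * s = s * 3 by omega),
          if_pos (show 1 + 3 * s = s * 3 + 1 by omega),
          if_neg (show ¬ 2 + 3 * s < s * 3 by omega), if_neg (show ¬ 2 + 3 * s = s * 3 by omega),
          if_neg (show ¬ 2 + 3 * s = s * 3 + 1 by omega)]
        exact ⟨m1, m2, m3⟩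

namespace ZeroOneMatrix

/-- The positions of the 1s of a matrix. -/
def support {n m : ℕ} (A : ZeroOneMatrix n m) : Finset (ℕ × ℕ) :=
  (Finset.univ.filter fun p : Fin n × Fin m => A p.1 p.2 = 1).image fun p => (p.1.val, p.2.val)

theorem card_support {n m : ℕ} (A : ZeroOneMatrix n m) : A.support.card = A.weight := by
  refine Finset.card_image_of_injective _ fun p q e => ?_
  simp only [Prod.mk.injEq] at e
  exact Prod.ext (Fin.ext e.1) (Fin.ext e.2)

theorem mem_support {n m : ℕ} {A : ZeroOneMatrix n m} {r c : ℕ} :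
    (r, c) ∈ A.support ↔ ∃ (hr : r < n) (hc : c < m), A ⟨r, hr⟩ ⟨c, hc⟩ = 1 := by
  simp only [support, Finset.mem_image, Finset.mem_filter, Finset.mem_univ, true_and,
    Prod.mk.injEq]
  constructor
  · rintro ⟨⟨i, j⟩, h, rfl, rfl⟩
    exact ⟨i.2, j.2, h⟩
  · rintro ⟨hr, hc, h⟩
    exact ⟨(⟨r, hr⟩, ⟨c, hc⟩), h, rfl, rfl⟩

theorem contains_of_hatChain {n k : ℕ} {A : ZeroOneMatrix n n} (h : HatChain A.support k n n) :
    Contains (kron (1 : ZeroOneMatrix k k) hat) A := by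
  obtain ⟨f, g, hf, hfr, hg, hgc, hS⟩ := h.exists_seq
  refine ⟨fun i => ⟨f i, hfr i i.2⟩, fun j => ⟨g j, hgc j j.2⟩, fun i j hij => hf i j hij j.2,
    fun i j hij => hg i j hij j.2, fun i j hij => ?_⟩
  obtain ⟨⟨i₁, i₂⟩, rfl⟩ := finProdFinEquiv.surjective i
  obtain ⟨⟨j₁, j₂⟩, rfl⟩ := finProdFinEquiv.surjective j
  simp only [kron, Matrix.reindex_apply, Matrix.submatrix_apply, Equiv.symm_apply_apply,
    Matrix.kroneckerMap_apply] at hij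
  have e : i₁ = j₁ := by
    by_contra hne
    rw [Matrix.one_apply_ne hne, zero_mul] at hij
    exact absurd hij (by decide)
  subst e
  rw [Matrix.one_apply_eq, one_mul] at hij
  have key : (f (finProdFinEquiv (i₁, i₂)).val, g (finProdFinEquiv (i₁, j₂)).val) ∈ A.support := by
    obtain ⟨h1, h2, h3⟩ := hS i₁ i₁.2
    simp only [finProdFinEquiv_apply_val]
    fin_cases i₂ <;> fin_cases j₂ <;> first
      | exact absurd hij (by decide)
      | simpa using h1
      | simpa using h2
      | simpa using h3
  obtain ⟨_, _, h⟩ := mem_support.1 key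
  exact h

end ZeroOneMatrix

/-! ### Rank classes -/

theorem rowCount_le {S : Finset (ℕ × ℕ)} {n : ℕ} (h : ∀ p ∈ S, p.1 < n) : rowCount S ≤ n := by
  have : S.image Prod.fst ⊆ Finset.range n := fun r hr => by
    obtain ⟨p, hp, rfl⟩ := Finset.mem_image.1 hr
    exact Finset.mem_range.2 (h p hp)
  simpa [rowCount] using Finset.card_le_card this

open Classical in
/-- A set without hats in a square of side `n` has at most `3 n` points. -/
theorem card_le_of_hatFree {S : Finset (ℕ × ℕ)} {n : ℕ} (hS : ∀ p ∈ S, p.1 < n ∧ p.2 < n)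
    (h : ∀ r₁ r₂ c₁ c₂ c₃ : ℕ, r₁ < r₂ → c₁ < c₂ → c₂ < c₃ → (r₁, c₂) ∈ S → (r₂, c₁) ∈ S →
      (r₂, c₃) ∉ S) : S.card ≤ 3 * n := by
  rcases Nat.eq_zero_or_pos n with rfl | hn
  · have : S = ∅ := Finset.eq_empty_of_forall_notMem fun p hp => by have := hS p hp; omega
    simp [this]
  have hrow := rowCount_le fun p hp => (hS p hp).1
  have h1 := Finset.card_filter_add_card_filter_not (s := S)
    fun p => ∀ q ∈ S, q.1 = p.1 → p.2 ≤ q.2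
  have h2 := Finset.card_filter_add_card_filter_not
    (s := S.filter fun p => ¬ ∀ q ∈ S, q.1 = p.1 → p.2 ≤ q.2)
    fun p => ∀ q ∈ S, q.1 = p.1 → q.2 ≤ p.2
  have h3 : (S.filter fun p => ∀ q ∈ S, q.1 = p.1 → p.2 ≤ q.2).card ≤ rowCount S := by
    refine card_le_rowCount (fun p hp => ⟨p, (Finset.mem_filter.1 hp).1, rfl⟩) ?_
    intro p hp q hq e
    rw [Finset.mem_filter] at hp hq
    exact le_antisymm (hp.2 q hq.1 e.symm) (hq.2 p hp.1 e)
  have h4 : ((S.filter fun p => ¬ ∀ q ∈ S, q.1 = p.1 → p.2 ≤ q.2).filter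
      fun p => ∀ q ∈ S, q.1 = p.1 → q.2 ≤ p.2).card ≤ rowCount S := by
    refine card_le_rowCount (fun p hp => ⟨p, (Finset.mem_filter.1 (Finset.mem_filter.1 hp).1).1,
      rfl⟩) ?_
    intro p hp q hq e
    rw [Finset.mem_filter, Finset.mem_filter] at hp hq
    exact le_antisymm (hq.2 p hp.1.1 e) (hp.2 q hq.1.1 e.symm)
  have h5 : ((S.filter fun p => ¬ ∀ q ∈ S, q.1 = p.1 → p.2 ≤ q.2).filter
      fun p => ¬ ∀ q ∈ S, q.1 = p.1 → q.2 ≤ p.2).card ≤ (n - 1) + 1 := by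
    refine card_le_of_col (a := 0) (fun p hp => ?_) fun p hp q hq e hlt => ?_
    · rw [Finset.mem_filter, Finset.mem_filter] at hp
      have := hS p hp.1.1
      omega
    · rw [Finset.mem_filter, Finset.mem_filter] at hp hq
      obtain ⟨⟨mp, -⟩, -⟩ := hp
      obtain ⟨⟨mq, hq1⟩, hq2⟩ := hq
      obtain ⟨r₁, c₂⟩ := p
      obtain ⟨r₂, c⟩ := q
      push Not at hq1 hq2
      obtain ⟨⟨r, c₁⟩, m1, rfl, h12⟩ := hq1
      obtain ⟨⟨r', c₃⟩, m3, hr', h23⟩ := hq2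
      dsimp only at e hlt h12 h23 hr'
      subst e hr'
      exact h _ _ _ _ _ hlt h12 h23 mp m1 m3
  omega

open Classical in
/-- The points weakly dominating a chain of `t` hats, but none of `t + 1` hats. -/
noncomputable def rankClass (S : Finset (ℕ × ℕ)) (t : ℕ) : Finset (ℕ × ℕ) :=
  S.filter fun p => HatChain S t (p.1 + 1) (p.2 + 1) ∧ ¬ HatChain S (t + 1) (p.1 + 1) (p.2 + 1)

theorem mem_rankClass {S : Finset (ℕ × ℕ)} {t : ℕ} {p : ℕ × ℕ} : p ∈ rankClass S t ↔
    p ∈ S ∧ HatChain S t (p.1 + 1) (p.2 + 1) ∧ ¬ HatChain S (t + 1) (p.1 + 1) (p.2 + 1) := by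
  simp [rankClass]

theorem subset_biUnion_rankClass {S : Finset (ℕ × ℕ)} {n k : ℕ}
    (hS : ∀ p ∈ S, p.1 < n ∧ p.2 < n) (h : ¬ HatChain S (k + 1) n n) :
    S ⊆ (Finset.range (k + 1)).biUnion (rankClass S) := by
  classical
  intro p hp
  have hex : ∃ t, ¬ HatChain S (t + 1) (p.1 + 1) (p.2 + 1) :=
    ⟨k, fun hh => h (hh.mono (hS p hp).1 (hS p hp).2)⟩
  refine Finset.mem_biUnion.2 ⟨Nat.find hex, Finset.mem_range.2 (Nat.lt_succ_of_le
    (Nat.find_min' hex fun hh => h (hh.mono (hS p hp).1 (hS p hp).2))),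
    mem_rankClass.2 ⟨hp, ?_, Nat.find_spec hex⟩⟩
  rcases hf : Nat.find hex with _ | t
  · trivial
  · exact not_not.1 (Nat.find_min hex (by omega : t < Nat.find hex))

theorem card_rankClass_zero_le {S : Finset (ℕ × ℕ)} {n : ℕ} (hS : ∀ p ∈ S, p.1 < n ∧ p.2 < n) :
    (rankClass S 0).card ≤ 3 * n := by
  refine card_le_of_hatFree (fun p hp => hS p (mem_rankClass.1 hp).1) ?_
  intro r₁ r₂ c₁ c₂ c₃ hr h12 h23 m1 m2 m3
  obtain ⟨m3, -, h3⟩ := mem_rankClass.1 m3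
  exact h3 ⟨r₁, r₂, c₁, c₂, c₃, hr, Nat.lt_succ_self _, h12, h23, Nat.lt_succ_self _,
    (mem_rankClass.1 m1).1, (mem_rankClass.1 m2).1, m3, trivial⟩

open Classical in
theorem card_rankClass_le {S : Finset (ℕ × ℕ)} {n N B : ℕ} (hn : 1 ≤ n)
    (hS : ∀ p ∈ S, p.1 < n ∧ p.2 < n) (hB : HatBound (n - 1) N B) (t : ℕ) :
    (rankClass S t).card ≤ N * n + B + 2 * n := by
  rw [← Finset.card_filter_add_card_filter_not (s := rankClass S t) fun p => HatChain S t p.1 p.2]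
  refine add_le_add ?_ ?_
  · set T := (rankClass S t).filter fun p => HatChain S t p.1 p.2 with hT
    have hTS : ∀ p ∈ T, p ∈ S := fun p hp => (mem_rankClass.1 (Finset.mem_filter.1 hp).1).1
    -- The infimum is attained in every row that meets `T`; its default 0 in other rows is harmless.
    have hgood : HatFreeBeyond T fun r => sInf {c | HatChain S t r c} := by
      constructor
      · intro p hp
        exact Nat.sInf_le (Finset.mem_filter.1 hp).2
      · intro r₁ r₂ c₁ c₂ c₃ hr h12 h23 m1 m2 m3
        by_contra hlt
        have hmem : HatChain S t r₁ (sInf {c | HatChain S t r₁ c}) :=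
          Nat.sInf_mem (s := {c | HatChain S t r₁ c}) ⟨c₂, (Finset.mem_filter.1 m1).2⟩
        refine (mem_rankClass.1 (Finset.mem_filter.1 m3).1).2.2 ?_
        exact ⟨r₁, r₂, c₁, c₂, c₃, hr, Nat.lt_succ_self _, h12, h23, Nat.lt_succ_self _,
          hTS _ m1, hTS _ m2, hTS _ m3, hmem.mono le_rfl (not_lt.1 hlt)⟩
    have h1 := hB T _ 0 hgood fun p hp => by have := hS p (hTS p hp); omega
    have h2 := Nat.mul_le_mul_left N (rowCount_le fun p hp => (hS p (hTS p hp)).1)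
    omega
  · rw [← Finset.card_range (2 * n)]
    -- This map indexes diagonals. Of two points on one diagonal, the chain weakly before the upper
    -- one is strictly before the lower one.
    refine Finset.card_le_card_of_injOn (fun p => p.1 + (n - p.2)) (fun p hp => ?_) ?_
    · have := hS p (mem_rankClass.1 (Finset.mem_filter.1 hp).1).1
      simp only [Finset.coe_range, Set.mem_Iio]
      omega
    · have key : ∀ p ∈ (rankClass S t).filter (fun p => ¬ HatChain S t p.1 p.2),
          ∀ q ∈ (rankClass S t).filter (fun p => ¬ HatChain S t p.1 p.2),
          p.1 + (n - p.2) = q.1 + (n - q.2) → ¬ p.1 < q.1 := by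
        intro p hp q hq e hlt
        rw [Finset.mem_filter, mem_rankClass] at hp hq
        have := hS p hp.1.1
        have := hS q hq.1.1
        exact hq.2 (hp.1.2.1.mono (by omega) (by omega))
      intro p hp q hq e
      have h1 := key p hp q hq e
      have h2 := key q hq p hp e.symm
      have h3 := hS p (mem_rankClass.1 (Finset.mem_filter.1 hp).1).1
      have h4 := hS q (mem_rankClass.1 (Finset.mem_filter.1 hq).1).1
      dsimp only at e
      exact Prod.ext (by omega) (by omega)

theorem card_le_of_not_hatChain {S : Finset (ℕ × ℕ)} {n k : ℕ} (hn : 1 ≤ n)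
    (hS : ∀ p ∈ S, p.1 < n ∧ p.2 < n) (h : ¬ HatChain S (k + 1) n n) :
    S.card ≤ k * (2 * invAck n * n + 22 * n) + 3 * n := by
  obtain ⟨h1, h2⟩ := invAck_spec hn
  obtain ⟨i, hi⟩ := Nat.exists_eq_succ_of_ne_zero (by omega : invAck n ≠ 0)
  rw [hi] at h2
  have hB := hatBound_of_lt_ackTable_three (i := i) (D := n - 1) (by
    rw [Nat.succ_eq_add_one] at h2; omega)
  have h3 := (Finset.card_le_card (subset_biUnion_rankClass hS h)).trans Finset.card_biUnion_le
  -- Rank 0 is split off, so that only `k` of the `k + 1` classes pay the inverse-Ackermann factor.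
  rw [Finset.sum_range_succ'] at h3
  have h4 := Finset.sum_le_card_nsmul (Finset.range k) (fun t => (rankClass S (t + 1)).card) _
    fun t _ => card_rankClass_le hn hS hB (t + 1)
  have h5 := card_rankClass_zero_le hS
  rw [Finset.card_range, smul_eq_mul] at h4
  have e : (2 * (i + 1) + 4) * n + 16 * (n - 1 + 1) + 2 * n = 2 * invAck n * n + 22 * n := by
    rw [hi, Nat.sub_add_cancel hn, Nat.succ_eq_add_one]
    ring
  rw [e] at h4
  omega

theorem mainTheorem4 :
    ∃ C : ℝ, ∀ k n : ℕ, 1 ≤ k → 1 ≤ n →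
      (ZeroOneMatrix.Ex
          (ZeroOneMatrix.kron (1 : ZeroOneMatrix k k) ZeroOneMatrix.hat) n : ℝ)
        ≤ 2 * ((k : ℝ) - 1) * n * invAck n + C * k * n := by
  -- 25 = 22 + 3: the linear cost of a class of positive rank plus that of rank 0.
  refine ⟨25, fun k n hk hn => ?_⟩
  obtain ⟨k, rfl⟩ := Nat.exists_eq_add_of_le' hk
  have h : ZeroOneMatrix.Ex
      (ZeroOneMatrix.kron (1 : ZeroOneMatrix (k + 1) (k + 1)) ZeroOneMatrix.hat) n
      ≤ k * (2 * invAck n * n + 22 * n) + 3 * n := by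
    unfold ZeroOneMatrix.Ex ZeroOneMatrix.Ex₂
    refine Finset.sup_le fun A hA => ?_
    simp only [Finset.mem_filter, Finset.mem_univ, true_and] at hA
    rw [← ZeroOneMatrix.card_support]
    refine card_le_of_not_hatChain hn (fun p hp => ?_)
      fun hc => hA (ZeroOneMatrix.contains_of_hatChain hc)
    obtain ⟨hr, hc, -⟩ := ZeroOneMatrix.mem_support.1 hp
    exact ⟨hr, hc⟩
  have h' : (ZeroOneMatrix.Ex
      (ZeroOneMatrix.kron (1 : ZeroOneMatrix (k + 1) (k + 1)) ZeroOneMatrix.hat) n : ℝ)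
      ≤ k * (2 * invAck n * n + 22 * n) + 3 * n := by exact_mod_cast h
  refine h'.trans ?_
  push_cast
  have h1 : (0 : ℝ) ≤ (k : ℝ) * n := by positivity
  have h2 : (0 : ℝ) ≤ n := by positivity
  nlinarith
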